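/- Let $k$ be a field and let $R=k\{x_1,\dots,x_n;Q,\preceq\}$ be a Poincaré–Birkhoff–Witt (PBW) algebra: $\preceq$ is an admissible order on $\mathbb N^n$ (a total order, compatible with addition, with least element $0$), $Q=\{x_jx_i-q_{ji}x_ix_j-p_{ji}: 1\le i<j\le n\}$ with $q_{ji}\in k^{*}$ and $p_{ji}$ a finite $k$-linear combination of standard monomials $x^\alpha=x_1^{\alpha_1}\cdots x_n^{\alpha_n}$ with $\alpha\prec\epsilon_i+\epsilon_j$, $R$ is the quotient of the free algebra $k\langle x_1,\dots,x_n\rangle$ by the two-sided ideal generated by $Q$, and the standard monomials form a $k$-basis of $R$. Let $R^{\rm env}=R\otimes_kR^{\rm op}$. $R$-bimodules are regarded as left $R^{\rm env}$-modules; on $R^m$ the action is $(r\otimes r')(f_1,\dots,f_m)=(rf_1r',\dots,rf_mr')$, and ${}_R\langle F\rangle_R$ denotes the bimodule generated by $F$. Let $\mathfrak m^s:(R^{\rm env})^s\to R^s$ be the map applying $r\otimes r'\mapsto rr'$ in each component. For a matrix $F$ over $R$ with rows $F_1,\dots,F_m\in R^q$, let $\mathrm{Syz}(F)\subseteq(R^{\rm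 env})^m$ be the kernel of $(h_1,\dots,h_m)\mapsto\sum_i h_iF_i\in R^q$. Orders and Gröbner bases. The algebra $R^{\rm env}$ has the $k$-basis of standard monomials $x^\alpha\otimes x^{\beta^{\rm op}}$ with exponents $(\alpha,\beta)\in\mathbb N^n\times\mathbb N^n=\mathbb N^{2n}$, where $\beta^{\rm op}=(\beta_n,\dots,\beta_1)$. Put $\beta\prec^{\rm op}\delta$ iff $\beta^{\rm op}\prec\delta^{\rm op}$. On $\mathbb N^{2n}$ take any one of the following orders: the composition order $\preceq^c$ (respectively $\preceq_c$), for which $(\alpha,\beta)$ is smaller than $(\gamma,\delta)$ iff $\alpha+\beta^{\rm op}\prec\gamma+\delta^{\rm op}$, or $\alpha+\beta^{\rm op}=\gamma+\delta^{\rm op}$ and $\beta^{\rm op}\prec\delta^{\rm op}$ (respectively $\alpha\prec\gamma$); or an elimination order arising from $\preceq$ and $\preceq^{\rm op}$, i.e. an admissible order on $\mathbb N^{2n}$ that restricts to $\preceq$ on $\mathbb N^n\times 0$ and to $\preceq^{\rm op}$ on $0\times\mathbb N^n$ and such that either every $(\alpha,\beta)$ with $\beta\ne0$ is greater than all $(\gamma,0)$,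 or every $(\alpha,\beta)$ with $\alpha\neq0$ is greater than all $(0,\delta)$. For $A=R$ or $A=R^{\rm env}$, with the exponents $E=\mathbb N^n$ or $\mathbb N^{2n}$, the order POT on $E\times\{1,\dots,m\}$ is: $(\alpha,i)\prec(\beta,j)$ iff $i>j$, or $i=j$ and $\alpha\prec\beta$. For $0\ne f\in A^m$ let $\exp(f)$ be the POT-largest $(\alpha,i)$ such that the standard monomial with exponent $\alpha$ occurs in the $i$-th component of $f$, and for $M\subseteq A^m$ let $\mathrm{Exp}(M)=\{\exp(f):0\neq f\in M\}$. A finite set $G\subseteq M\setminus\{0\}$ is a left Gröbner basis of a left submodule $M\subseteq A^m$ for POT if $\mathrm{Exp}(M)=\bigcup_{g\in G}(E+\exp(g))$, where $\gamma+(\alpha,i)=(\gamma+\alpha,i)$. A finite set $G\subseteq M\setminus\{0\}$ is a two-sided Gröbner basis of a subbimodule $M\subseteq R^m$ for POT if $M={}_R\langle G\rangle_R$ and $\mathrm{Exp}(M)=\bigcup_{g\in G}(\mathbb N^n+\exp(g))$. Let $M_i={}_R\langle f^i_1,\dots,f^i_{t_i}\rangle_R\subseteq R^s$ for $i=1,\dots,r$,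 and let $H\in M_{(s+\sum_i t_i)\times rs}(R)$ be the matrix, with $r$ blocks of $s$ columns, whose first $s$ rows are $(I_s\ \cdots\ I_s)$ and whose further rows are, for $i=1,\dots,r$ and $j=1,\dots,t_i$ in lexicographic order, $f^i_j$ in the $i$-th block of columns and $0$ in the other blocks. Suppose $\mathrm{Syz}(H)={}_R\langle g_1,\dots,g_T\rangle_R$ (that is, $g_1,\dots,g_T$ generate it as a left $R^{\rm env}$-module), with $g_k=(g_k',g_k'')\in(R^{\rm env})^s\times(R^{\rm env})^{\sum_i t_i}$. Then $$\bigcap_{i=1}^rM_i={}_R\langle\mathfrak m^s(g_1'),\dots,\mathfrak m^s(g_T')\rangle_R .$$ If moreover $\{g_1,\dots,g_T\}$ is a left Gröbner basis of the left $R^{\rm env}$-module $\mathrm{Syz}(H)$ for POT and one of the above orders on $\mathbb N^{2n}$, then $\{\mathfrak m^s(g_1'),\dots,\mathfrak m^s(g_T')\}\setminus\{0\}$ is a two-sided Gröbner basis of $\bigcap_{i=1}^rM_i$ for POT and $\preceq$. -/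

import Mathlib

open TensorProduct

namespace PBW

/-! ## Admissible orders and PBW algebras -/

/-- A (strict) admissible order on a commutative monoid of exponents such as `ℕⁿ`: a total order
with least element `0`, compatible with addition. -/
structure IsAdmissible {E : Type*} [AddCommMonoid E] (prec : E → E → Prop) : Prop where
  strictTotal : IsStrictTotalOrder E prec
  zero_prec : ∀ α : E, α ≠ 0 → prec 0 α
  add_right : ∀ α β γ : E, prec α β → prec (α + γ) (β + γ)

/-- The standard monomial `x^α = x₁^α₁ ⋯ xₙ^αₙ` (product taken in this order). -/
def stdMonomial {A : Type*} [Monoid A] {n : ℕ} (x : Fin n → A) (α : Fin n → ℕ) : A :=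
  (List.ofFn fun i => x i ^ α i).prod

/-- The linear combination of standard monomials with coefficients `c`, in the free algebra. -/
noncomputable def stdComb {k : Type*} [Field k] {n : ℕ} (c : (Fin n → ℕ) →₀ k) :
    FreeAlgebra k (Fin n) :=
  c.sum fun α a => a • stdMonomial (FreeAlgebra.ι k) α

/-- The set `{xⱼxᵢ - qⱼᵢ xᵢxⱼ - pⱼᵢ ; i < j}` in the free algebra. -/
def quantumRelations {k : Type*} [Field k] {n : ℕ} (q : Fin n → Fin n → k)
    (p : Fin n → Fin n → (Fin n → ℕ) →₀ k) : Set (FreeAlgebra k (Fin n)) :=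
  {a | ∃ i j : Fin n, i < j ∧
    a = FreeAlgebra.ι k j * FreeAlgebra.ι k i
      - q j i • (FreeAlgebra.ι k i * FreeAlgebra.ι k j) - stdComb (p j i)}

end PBW

/-- `PBWAlgebra k R n`: a presentation `R = k{x₁, …, xₙ; Q, ≺}` of the `k`-algebra `R` as a
Poincaré-Birkhoff-Witt algebra. -/
structure PBWAlgebra (k R : Type*) [Field k] [Ring R] [Algebra k R] (n : ℕ) where
  /-- the generators -/
  x : Fin n → R
  /-- the scalars `qⱼᵢ` of the quantum relations -/
  q : Fin n → Fin n → k
  /-- the coefficients of the tails `pⱼᵢ` of the quantum relations -/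
  p : Fin n → Fin n → (Fin n → ℕ) →₀ k
  /-- the strict admissible order on `ℕⁿ` -/
  prec : (Fin n → ℕ) → (Fin n → ℕ) → Prop
  admissible : PBW.IsAdmissible prec
  q_ne_zero : ∀ i j, i < j → q j i ≠ 0
  /-- `exp(pⱼᵢ) ≺ εᵢ + εⱼ` -/
  p_bounded : ∀ i j, i < j → ∀ α ∈ (p j i).support, prec α (Pi.single i 1 + Pi.single j 1)
  /-- `R` is the quotient of the free algebra by the two-sided ideal generated by `Q` -/
  lift_surjective : Function.Surjective (FreeAlgebra.lift k x)
  lift_ker : ∀ a : FreeAlgebra k (Fin n),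
    FreeAlgebra.lift k x a = 0 ↔ a ∈ TwoSidedIdeal.span (PBW.quantumRelations q p)
  /-- the standard monomials form a `k`-basis of `R` -/
  linearIndependent : LinearIndependent k (PBW.stdMonomial x)
  span_eq_top : Submodule.span k (Set.range (PBW.stdMonomial x)) = ⊤

namespace PBW

/-- The basis of standard monomials of `R`. -/
noncomputable def stdBasis {k R : Type*} [Field k] [Ring R] [Algebra k R] {n : ℕ}
    (P : PBWAlgebra k R n) : Module.Basis (Fin n → ℕ) k R :=
  Module.Basis.mk P.linearIndependent P.span_eq_top.ge

/-! ## The enveloping algebra and bimodules -/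

/-- The enveloping algebra `R ⊗ₖ Rᵒᵖ`. -/
abbrev Env (k R : Type*) [Field k] [Ring R] [Algebra k R] : Type _ := R ⊗[k] Rᵐᵒᵖ

/-- `R` as a left module over its enveloping algebra. With the resulting componentwise action on
`R^s`, the `R`-subbimodules of `R^s` are the `Submodule (Env k R)`s. -/
noncomputable instance envModule (k R : Type*) [Field k] [Ring R] [Algebra k R] :
    Module (Env k R) R := instModuleTensorProductMop k R

theorem env_smul {k R : Type*} [Field k] [Ring R] [Algebra k R] (r r' f : R) :
    (r ⊗ₜ[k] MulOpposite.op r' : Env k R) • f = r * f * r' :=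
  AlgHom.mulLeftRight_apply k R r (MulOpposite.op r') f

/-- The map `𝔪 : R ⊗ Rᵒᵖ → R`, `r ⊗ r' ↦ r r'`. -/
noncomputable def mulMap (k R : Type*) [Field k] [Ring R] [Algebra k R] : Env k R →ₗ[k] R :=
  LinearMap.mul' k R ∘ₗ LinearMap.lTensor R (MulOpposite.opLinearEquiv k).symm.toLinearMap

theorem mulMap_tmul {k R : Type*} [Field k] [Ring R] [Algebra k R] (r r' : R) :
    mulMap k R (r ⊗ₜ[k] MulOpposite.op r') = r * r' := by
  simp [mulMap]

/-- The map `𝔪^s`, componentwise `𝔪`. -/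
noncomputable def mulMapPi {k R ι : Type*} [Field k] [Ring R] [Algebra k R]
    (h : ι → Env k R) : ι → R :=
  fun i => mulMap k R (h i)

/-- The tuple `α^op = (αₙ, …, α₁)`. -/
def opTuple {n : ℕ} (α : Fin n → ℕ) : Fin n → ℕ := fun i => α i.rev

/-- `α ↦ α^op` as a permutation of `ℕⁿ`. -/
def opTupleEquiv (n : ℕ) : (Fin n → ℕ) ≃ (Fin n → ℕ) where
  toFun := opTuple
  invFun := opTuple
  left_inv α := by funext i; simp [opTuple]
  right_inv α := by funext i; simp [opTuple]

/-- The basis of standard monomials of `R ⊗ Rᵒᵖ`, for the generators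
`x₁ ⊗ 1, …, xₙ ⊗ 1, 1 ⊗ xₙ, …, 1 ⊗ x₁` in this order. Exponents in `ℕ^{2n}` are written as pairs
`(α, β) ∈ ℕⁿ × ℕⁿ`. -/
noncomputable def envBasis {k R : Type*} [Field k] [Ring R] [Algebra k R] {n : ℕ}
    (P : PBWAlgebra k R n) : Module.Basis ((Fin n → ℕ) × (Fin n → ℕ)) k (Env k R) :=
  ((stdBasis P).tensorProduct ((stdBasis P).map (MulOpposite.opLinearEquiv k))).reindex
    (Equiv.prodCongr (Equiv.refl _) (opTupleEquiv n))

theorem envBasis_apply {k R : Type*} [Field k] [Ring R] [Algebra k R] {n : ℕ}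
    (P : PBWAlgebra k R n) (α β : Fin n → ℕ) :
    envBasis P (α, β) =
      stdMonomial P.x α ⊗ₜ[k] MulOpposite.op (stdMonomial P.x (opTuple β)) := by
  simp [envBasis, stdBasis, opTupleEquiv, Module.Basis.tensorProduct_apply]

/-! ## Orders on the exponents of the enveloping algebra -/

/-- The up-component composition order `≺^c`. -/
def compUp {n : ℕ} (prec : (Fin n → ℕ) → (Fin n → ℕ) → Prop)
    (a b : (Fin n → ℕ) × (Fin n → ℕ)) : Prop :=
  prec (a.1 + opTuple a.2) (b.1 + opTuple b.2) ∨
    (a.1 + opTuple a.2 = b.1 + opTuple b.2 ∧ prec (opTuple a.2) (opTuple b.2))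

/-- The down-component composition order `≺_c`. -/
def compDown {n : ℕ} (prec : (Fin n → ℕ) → (Fin n → ℕ) → Prop)
    (a b : (Fin n → ℕ) × (Fin n → ℕ)) : Prop :=
  prec (a.1 + opTuple a.2) (b.1 + opTuple b.2) ∨
    (a.1 + opTuple a.2 = b.1 + opTuple b.2 ∧ prec a.1 b.1)

/-- `precE` is an elimination order on `ℕ^{2n}` arising from `≺` and `≺^op`: an admissible order
which restricts to `≺` on the first block of variables and to `≺^op` on the second block, and for
which every monomial involving a variable of one chosen block is greater than all the monomials
in the variables of the other block. The product orders (lexicographic, comparing one of the two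
blocks first) are of this kind. -/
structure IsElimOrder {n : ℕ} (prec : (Fin n → ℕ) → (Fin n → ℕ) → Prop)
    (precE : (Fin n → ℕ) × (Fin n → ℕ) → (Fin n → ℕ) × (Fin n → ℕ) → Prop) : Prop where
  admissible : IsAdmissible precE
  restrict_left : ∀ α γ, precE (α, 0) (γ, 0) ↔ prec α γ
  restrict_right : ∀ β δ, precE (0, β) (0, δ) ↔ prec (opTuple β) (opTuple δ)
  elim : (∀ α β γ, β ≠ 0 → precE (γ, 0) (α, β)) ∨ (∀ α β δ, α ≠ 0 → precE (0, δ) (α, β))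

/-- The orders considered on the enveloping algebra: composition orders and elimination orders. -/
def IsEnvOrder {n : ℕ} (prec : (Fin n → ℕ) → (Fin n → ℕ) → Prop)
    (precE : (Fin n → ℕ) × (Fin n → ℕ) → (Fin n → ℕ) × (Fin n → ℕ) → Prop) : Prop :=
  precE = compUp prec ∨ precE = compDown prec ∨ IsElimOrder prec precE

/-! ## Exponents and Gröbner bases in free modules, for the order POT

Here `A` is an algebra with a `k`-basis `b` of standard monomials indexed by the exponents `E`,
and `A^ι` is the free module with positions in the linearly ordered type `ι`. -/

/-- The order POT (position over term); smaller positions are greater. -/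
def pot {E ι : Type*} [LT ι] (prec : E → E → Prop) (a b : E × ι) : Prop :=
  b.2 < a.2 ∨ (a.2 = b.2 ∧ prec a.1 b.1)

/-- `exp(f) = a`: `a` is the exponent of the leading term of `f` for POT. (No such `a` exists
for `f = 0`.) -/
def IsExp {k A E ι : Type*} [Field k] [Ring A] [Algebra k A] [LT ι] (b : Module.Basis E k A)
    (prec : E → E → Prop) (f : ι → A) (a : E × ι) : Prop :=
  b.repr (f a.2) a.1 ≠ 0 ∧ ∀ c : E × ι, b.repr (f c.2) c.1 ≠ 0 → c = a ∨ pot prec c a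

/-- `Exp(M)`, the set of exponents of the nonzero elements of `M`. -/
def expSet {k A E ι : Type*} [Field k] [Ring A] [Algebra k A] [LT ι] (b : Module.Basis E k A)
    (prec : E → E → Prop) (M : Set (ι → A)) : Set (E × ι) :=
  {a | ∃ f ∈ M, IsExp b prec f a}

/-- `⋃_{g ∈ G} (E + exp(g))`. -/
def expCone {k A E ι : Type*} [Field k] [Ring A] [Algebra k A] [LT ι] [Add E]
    (b : Module.Basis E k A) (prec : E → E → Prop) (G : Set (ι → A)) : Set (E × ι) :=
  {a | ∃ g ∈ G, ∃ e : E × ι, IsExp b prec g e ∧ ∃ γ : E, a = (γ + e.1, e.2)}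

/-- `G` is a left Gröbner basis of the left submodule `M` of `A^ι` for POT. -/
def IsLeftGrobnerBasis {k A E ι : Type*} [Field k] [Ring A] [Algebra k A] [LT ι] [Add E]
    (b : Module.Basis E k A) (prec : E → E → Prop) (M : Submodule A (ι → A))
    (G : Set (ι → A)) : Prop :=
  G.Finite ∧ G ⊆ (M : Set (ι → A)) \ {0} ∧
    expSet b prec (M : Set (ι → A)) = expCone b prec G

/-- `G` is a two-sided Gröbner basis of the subbimodule `M` of `R^ι` for POT. -/
def IsTwoSidedGrobnerBasis {k R ι : Type*} [Field k] [Ring R] [Algebra k R] [LT ι] {n : ℕ}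
    (P : PBWAlgebra k R n) (M : Submodule (Env k R) (ι → R)) (G : Set (ι → R)) : Prop :=
  G.Finite ∧ G ⊆ (M : Set (ι → R)) \ {0} ∧ M = Submodule.span (Env k R) G ∧
    expSet (stdBasis P) P.prec (M : Set (ι → R)) = expCone (stdBasis P) P.prec G

/-! ## Syzygy bimodules -/

/-- `Syz(F)`: the kernel of `(Rᵉⁿᵛ)^ι → R^κ`, `h ↦ ∑ᵢ hᵢ Fᵢ`, where `Fᵢ` is the `i`-th row. -/
noncomputable def syz (k : Type*) {R ι κ : Type*} [Field k] [Ring R] [Algebra k R] [Fintype ι]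
    (F : Matrix ι κ R) : Submodule (Env k R) (ι → Env k R) :=
  LinearMap.ker (Fintype.linearCombination (Env k R) (fun i => F i : ι → κ → R))

/-- The row positions `1, …, s + t₁ + ⋯ + t_r` of the matrix `H`: first `s` positions, then a
block of `tᵢ` positions for each `i`, in lexicographic order. -/
abbrev RowIdx (s : ℕ) {r : ℕ} (t : Fin r → ℕ) : Type :=
  Fin s ⊕ₗ (Σₗ i : Fin r, Fin (t i))

/-- The matrix `H` with `r` blocks of `s` columns: the first `s` rows are `(I_s … I_s)`, and the
row of index `(i, j)` is `f_jⁱ` in the `i`-th block of columns and `0` in the others. -/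
def matrixH {R : Type*} [Ring R] {s r : ℕ} {t : Fin r → ℕ}
    (f : (i : Fin r) → Fin (t i) → (Fin s → R)) : Matrix (RowIdx s t) (Fin r × Fin s) R :=
  Matrix.of fun a c =>
    match ofLex a with
    | Sum.inl l => if l = c.2 then 1 else 0
    | Sum.inr b => if (ofLex b).1 = c.1 then f (ofLex b).1 (ofLex b).2 c.2 else 0

/-- The part `h' ∈ (Rᵉⁿᵛ)^s` of `h = (h', h'')`. -/
def firstPart {B : Type*} {s r : ℕ} {t : Fin r → ℕ} (h : RowIdx s t → B) : Fin s → B :=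
  fun l => h (toLex (Sum.inl l))

end PBW

/-! By the identity blocks of `H`, a pair (h', h'') is a syzygy iff 𝔪^s(h') = -∑ⱼ h''ᵢⱼ fⱼⁱ for
every i. So (h', h'') ↦ 𝔪^s(h') is a bimodule map from Syz(H) onto ⋂ Mᵢ (`map_firstMul_syz`), and
generators go to generators.

For Gröbner bases, 𝔪 sends the monomial of exponent (α, β) to a nonzero multiple of x^(α + β^op)
plus smaller terms (`agreeMod_mulMap`). Leading terms may still cancel, as different (α, β) can have
the same total α + β^op. The cure is to lift u ∈ ⋂ Mᵢ to u ⊗ 1 or 1 ⊗ u, whichever suits the order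
(`IsEnvOrder.left_or_right`). The leading exponent of the lift has a zero block, hence so does that
of any basis element g dividing it. All exponents below such an exponent have smaller total, so 𝔪^s
keeps the leading term of g', and exp(𝔪^s(g')) divides exp(u). -/

namespace PBW

/-! ### Admissible orders -/

section Order

variable {E : Type*} [AddCommMonoid E] {prec : E → E → Prop}

theorem IsAdmissible.irrefl (h : IsAdmissible prec) (a : E) : ¬ prec a a :=
  h.strictTotal.toIrrefl.irrefl a

theorem IsAdmissible.trans (h : IsAdmissible prec) {a b c : E} (hab : prec a b)
    (hbc : prec b c) : prec a c :=
  h.strictTotal.toIsTrans.trans a b c hab hbc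

theorem IsAdmissible.not_prec_zero (h : IsAdmissible prec) (a : E) : ¬ prec a 0 := by
  intro ha
  by_cases h0 : a = 0
  · exact h.irrefl 0 (h0 ▸ ha)
  · exact h.irrefl 0 (h.trans (h.zero_prec a h0) ha)

theorem IsAdmissible.eq_or_prec_add (h : IsAdmissible prec) (a b : E) :
    a = b + a ∨ prec a (b + a) := by
  by_cases h0 : b = 0
  · left; simp [h0]
  · right; simpa using h.add_right 0 b a (h.zero_prec b h0)

/-- An admissible order on `ℕⁿ` is a well order (Dickson's lemma). -/
theorem IsAdmissible.wellFounded {n : ℕ} {prec : (Fin n → ℕ) → (Fin n → ℕ) → Prop}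
    (h : IsAdmissible prec) : WellFounded prec := by
  have := h.strictTotal
  rw [RelEmbedding.wellFounded_iff_isEmpty]
  refine ⟨fun e => ?_⟩
  -- A descending sequence would have `e a ≤ e b` componentwise for some `a < b`, but adding
  -- exponents never decreases.
  obtain ⟨a, b, hab, hle⟩ := (wellQuasiOrdered_le (α := Fin n → ℕ)) e
  have h1 : prec (e b) (e a) := e.map_rel_iff.2 hab
  obtain ⟨c, hc⟩ := exists_add_of_le hle
  rcases h.eq_or_prec_add (e a) c with h2 | h2
  · rw [add_comm, ← hc] at h2
    exact h.irrefl _ (h2 ▸ h1)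
  · rw [add_comm, ← hc] at h2
    exact h.irrefl _ (h.trans h1 h2)

end Order

/-! ### Leading terms under linear maps -/

section Lower

variable {k A E : Type*} [Field k] [Ring A] [Algebra k A] (b : Module.Basis E k A)
  (prec : E → E → Prop)

/-- The elements all of whose exponents are smaller than `δ`. -/
noncomputable def lower (δ : E) : Submodule k A :=
  (Finsupp.supported k k {γ | prec γ δ}).comap b.repr.toLinearMap

variable {b prec}

theorem mem_lower {δ : E} {v : A} : v ∈ lower b prec δ ↔ ∀ γ, b.repr v γ ≠ 0 → prec γ δ := by
  simp [lower, Finsupp.mem_supported, Set.subset_def]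

theorem basis_mem_lower {γ δ : E} (h : prec γ δ) : b γ ∈ lower b prec δ := by
  classical
  rw [mem_lower]
  intro c hc
  rw [b.repr_self, Finsupp.single_apply] at hc
  split_ifs at hc with h1
  · exact h1 ▸ h
  · exact absurd rfl hc

theorem lower_mono (htr : ∀ a b c, prec a b → prec b c → prec a c) {γ δ : E} (h : prec γ δ) :
    lower b prec γ ≤ lower b prec δ := by
  intro v hv
  rw [mem_lower] at hv ⊢
  exact fun c hc => htr _ _ _ (hv c hc) h

theorem map_mem_of_mem_lower {V : Type*} [AddCommGroup V] [Module k V] (L : A →ₗ[k] V)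
    {N : Submodule k V} {δ : E} {v : A} (hv : v ∈ lower b prec δ)
    (h : ∀ γ, prec γ δ → L (b γ) ∈ N) : L v ∈ N := by
  rw [mem_lower] at hv
  rw [← b.linearCombination_repr v, Finsupp.linearCombination_apply, Finsupp.sum, map_sum]
  refine N.sum_mem fun γ hγ => ?_
  rw [map_smul]
  exact N.smul_mem _ (h γ (hv γ (Finsupp.mem_support_iff.1 hγ)))

variable (b prec) in
/-- `u` and `v` agree up to a nonzero scalar and terms smaller than `δ`. -/
def AgreeMod (δ : E) (u v : A) : Prop := ∃ c : k, c ≠ 0 ∧ u - c • v ∈ lower b prec δ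

theorem AgreeMod.refl (δ : E) (u : A) : AgreeMod b prec δ u u := ⟨1, one_ne_zero, by simp⟩

theorem AgreeMod.symm {δ : E} {u v : A} (h : AgreeMod b prec δ u v) : AgreeMod b prec δ v u := by
  obtain ⟨c, hc, h⟩ := h
  refine ⟨c⁻¹, inv_ne_zero hc, ?_⟩
  have := (lower b prec δ).smul_mem (-c⁻¹) h
  rwa [smul_sub, smul_smul, neg_mul, inv_mul_cancel₀ hc, neg_smul, neg_smul, one_smul,
    sub_neg_eq_add, neg_add_eq_sub] at this

theorem AgreeMod.trans {δ : E} {u v w : A} (h : AgreeMod b prec δ u v)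
    (h' : AgreeMod b prec δ v w) : AgreeMod b prec δ u w := by
  obtain ⟨c, hc, h⟩ := h
  obtain ⟨d, hd, h'⟩ := h'
  refine ⟨c * d, mul_ne_zero hc hd, ?_⟩
  have := (lower b prec δ).add_mem h ((lower b prec δ).smul_mem c h')
  rwa [smul_sub, smul_smul, sub_add_sub_cancel] at this

theorem AgreeMod.mem_lower_of_prec (htr : ∀ a b c, prec a b → prec b c → prec a c) {γ δ : E}
    {u : A} (h : AgreeMod b prec γ u (b γ)) (hγ : prec γ δ) : u ∈ lower b prec δ := by
  obtain ⟨c, -, h⟩ := h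
  rw [← sub_add_cancel u (c • b γ)]
  exact add_mem (lower_mono htr hγ h) (Submodule.smul_mem _ _ (basis_mem_lower hγ))

theorem AgreeMod.repr_ne_zero (hirr : ∀ a, ¬ prec a a) {δ : E} {u : A}
    (h : AgreeMod b prec δ u (b δ)) :
    b.repr u δ ≠ 0 ∧ ∀ γ, b.repr u γ ≠ 0 → γ = δ ∨ prec γ δ := by
  classical
  obtain ⟨c, hc, h⟩ := h
  rw [mem_lower] at h
  simp only [map_sub, map_smul, Module.Basis.repr_self, Finsupp.sub_apply, Finsupp.smul_apply,
    Finsupp.single_apply, smul_eq_mul] at h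
  constructor
  · intro h0
    refine hirr δ (h δ ?_)
    simpa [h0] using hc
  · intro γ hγ
    by_cases h1 : γ = δ
    · exact Or.inl h1
    · refine Or.inr (h γ ?_)
      rwa [if_neg (Ne.symm h1), mul_zero, sub_zero]

/-- A linear map which sends basis elements to basis elements, up to nonzero scalars and smaller
terms, sends leading terms to leading terms. -/
theorem agreeMod_map (htr : ∀ a b c, prec a b → prec b c → prec a c)
    {V E' : Type*} [AddCommGroup V] [Module k V] (b' : Module.Basis E' k V) (φ : V →ₗ[k] A)
    (d : E' → E) (hφ : ∀ e, AgreeMod b prec (d e) (φ (b' e)) (b (d e))) {v : V} {e₀ : E'}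
    (h₀ : b'.repr v e₀ ≠ 0) (h : ∀ e, b'.repr v e ≠ 0 → e = e₀ ∨ prec (d e) (d e₀)) :
    AgreeMod b prec (d e₀) (φ v) (b (d e₀)) := by
  classical
  obtain ⟨c, hc, hc'⟩ := hφ e₀
  refine AgreeMod.trans (v := φ (b' e₀)) ⟨b'.repr v e₀, h₀, ?_⟩ ⟨c, hc, hc'⟩
  have hv : φ v = ∑ e ∈ (b'.repr v).support, b'.repr v e • φ (b' e) := by
    conv_lhs => rw [← b'.linearCombination_repr v]
    simp [Finsupp.linearCombination_apply, Finsupp.sum, map_sum]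
  -- `d` need not be injective: it is enough that no other exponent of `v` reaches `d e₀`.
  rw [hv, ← Finset.add_sum_erase _ _ (Finsupp.mem_support_iff.2 h₀), add_sub_cancel_left]
  refine Submodule.sum_mem _ fun e he => Submodule.smul_mem _ _ ?_
  rw [Finset.mem_erase, Finsupp.mem_support_iff] at he
  exact (hφ e).mem_lower_of_prec htr ((h e he.2).resolve_left he.1)

/-- Monotonicity of `d` is needed only below `e₀`, because only terms in the leading position
compete with the leading term. Positions before it are zero in `g` and stay zero under `φ`. -/
theorem isExp_map (hirr : ∀ a, ¬ prec a a) (htr : ∀ a b c, prec a b → prec b c → prec a c)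
    {A' E' ι κ : Type*} [Ring A'] [Algebra k A'] {b' : Module.Basis E' k A'}
    {prec' : E' → E' → Prop} [LT ι] [LT κ] (φ : A' →ₗ[k] A) (d : E' → E)
    (hφ : ∀ e, AgreeMod b prec (d e) (φ (b' e)) (b (d e))) (u : ι → κ)
    (hu : Function.Injective u) (hlt : ∀ i j, u i < u j → i < j) {g : κ → A'} {e₀ : E'} {i : ι}
    (hirr' : ¬ i < i) (hg : IsExp b' prec' g (e₀, u i))
    (hd : ∀ e, prec' e e₀ → prec (d e) (d e₀)) :
    IsExp b prec (fun l => φ (g (u l))) (d e₀, i) := by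
  have hi : AgreeMod b prec (d e₀) (φ (g (u i))) (b (d e₀)) := by
    refine agreeMod_map htr b' φ d hφ hg.1 fun e he => ?_
    rcases hg.2 (e, u i) he with h | h | h
    · exact Or.inl (Prod.ext_iff.1 h).1
    · exact absurd (hlt _ _ h) hirr'
    · exact Or.inr (hd _ h.2)
  have := hi.repr_ne_zero hirr
  refine ⟨this.1, ?_⟩
  rintro ⟨γ, j⟩ hγ
  have hgj : g (u j) ≠ 0 := by
    intro h0
    simp [h0] at hγ
  obtain ⟨e, he⟩ : ∃ e, b'.repr (g (u j)) e ≠ 0 := by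
    by_contra! hcon
    exact hgj (b'.repr.map_eq_zero_iff.1 (Finsupp.ext hcon))
  have key : j = i ∨ i < j := by
    rcases hg.2 (e, u j) he with h | h | h
    · exact Or.inl (hu (Prod.ext_iff.1 h).2)
    · exact Or.inr (hlt _ _ h)
    · exact Or.inl (hu h.1)
  rcases key with rfl | hlt
  · rcases this.2 γ hγ with h | h
    · exact Or.inl (by rw [h])
    · exact Or.inr (Or.inr ⟨rfl, h⟩)
  · exact Or.inr (Or.inl hlt)

end Lower

/-! ### Words and their exponents -/

section Words

/-- The exponent of a word. -/
def wordExp {n : ℕ} (w : List (Fin n)) : Fin n → ℕ := fun i => w.count i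

theorem wordExp_cons {n : ℕ} (a : Fin n) (w : List (Fin n)) :
    wordExp (a :: w) = Pi.single a 1 + wordExp w := by
  funext i
  simp only [wordExp, List.count_cons, Pi.add_apply, Pi.single_apply, beq_iff_eq, eq_comm (a := a)]
  rw [add_comm]

theorem wordExp_append {n : ℕ} (v w : List (Fin n)) :
    wordExp (v ++ w) = wordExp v + wordExp w := by
  funext i
  simp [wordExp]

/-- The word `1 ⋯ 1 2 ⋯ 2 ⋯ n ⋯ n` with exponent `δ`. -/
def stdWord {n : ℕ} (δ : Fin n → ℕ) : List (Fin n) :=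
  (List.ofFn fun i => List.replicate (δ i) i).flatten

theorem wordExp_stdWord {n : ℕ} (δ : Fin n → ℕ) : wordExp (stdWord δ) = δ := by
  funext i
  simp [wordExp, stdWord, List.count_flatten, List.map_ofFn, Function.comp_def, List.sum_ofFn,
    List.count_replicate]

theorem prod_map_stdWord {A : Type*} [Monoid A] {n : ℕ} (x : Fin n → A) (δ : Fin n → ℕ) :
    ((stdWord δ).map x).prod = stdMonomial x δ := by
  simp [stdWord, stdMonomial, List.map_flatten, List.prod_flatten, List.map_ofFn,
    Function.comp_def]

theorem perm_stdWord {n : ℕ} (w : List (Fin n)) : w.Perm (stdWord (wordExp w)) := by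
  rw [List.perm_iff_count]
  intro i
  exact (congrFun (wordExp_stdWord (wordExp w)) i).symm

theorem stdMonomial_zero {A : Type*} [Monoid A] {n : ℕ} (x : Fin n → A) :
    stdMonomial x 0 = 1 := by
  simp [stdMonomial]

end Words

/-! ### Products of monomials in a PBW algebra -/

section Monomials

variable {k R : Type*} [Field k] [Ring R] [Algebra k R] {n : ℕ} (P : PBWAlgebra k R n)

theorem stdBasis_apply (α : Fin n → ℕ) : stdBasis P α = stdMonomial P.x α := by
  simp [stdBasis]

theorem gen_mul_gen {i j : Fin n} (h : i < j) :
    P.x j * P.x i - P.q j i • (P.x i * P.x j) ∈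
      lower (stdBasis P) P.prec (Pi.single i 1 + Pi.single j 1) := by
  have h1 := (P.lift_ker _).2 (TwoSidedIdeal.subset_span
    (show _ ∈ quantumRelations P.q P.p from ⟨i, j, h, rfl⟩))
  rw [map_sub, sub_eq_zero] at h1
  simp only [map_sub, map_mul, map_smul, FreeAlgebra.lift_ι_apply] at h1
  rw [h1, stdComb, Finsupp.sum, map_sum]
  refine Submodule.sum_mem _ fun α hα => ?_
  rw [map_smul]
  refine Submodule.smul_mem _ _ ?_
  have : FreeAlgebra.lift k P.x (stdMonomial (FreeAlgebra.ι k) α) = stdBasis P α := by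
    simp [stdBasis_apply, stdMonomial, map_list_prod, List.map_ofFn, Function.comp_def]
  rw [this]
  exact basis_mem_lower (P.p_bounded i j h α hα)

/-- Since qⱼᵢ is invertible, the quantum relation can be read in both directions. -/
theorem agreeMod_gen_mul_gen (i j : Fin n) :
    AgreeMod (stdBasis P) P.prec (Pi.single i 1 + Pi.single j 1)
      (P.x j * P.x i) (P.x i * P.x j) := by
  rcases lt_trichotomy i j with h | rfl | h
  · exact ⟨_, P.q_ne_zero i j h, gen_mul_gen P h⟩
  · exact AgreeMod.refl _ _
  · rw [add_comm]
    exact AgreeMod.symm ⟨_, P.q_ne_zero j i h, gen_mul_gen P h⟩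

/-- The product of the generators along a word. -/
def wordProd (w : List (Fin n)) : R := (w.map P.x).prod

theorem wordProd_cons (a : Fin n) (w : List (Fin n)) :
    wordProd P (a :: w) = P.x a * wordProd P w := by
  simp [wordProd]

theorem wordProd_append (v w : List (Fin n)) :
    wordProd P (v ++ w) = wordProd P v * wordProd P w := by
  simp [wordProd]

theorem wordProd_stdWord (δ : Fin n → ℕ) : wordProd P (stdWord δ) = stdBasis P δ := by
  rw [wordProd, prod_map_stdWord, stdBasis_apply]

theorem prec_trans (a b c : Fin n → ℕ) (hab : P.prec a b) (hbc : P.prec b c) : P.prec a c :=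
  P.admissible.trans hab hbc

/-- Each adjacent swap costs a nonzero scalar and terms which, inside the word, become words of
smaller exponent; `ih` shows that those contribute only smaller standard monomials. -/
theorem agreeMod_of_perm {v w : List (Fin n)} (h : v.Perm w)
    (ih : ∀ u : List (Fin n), P.prec (wordExp u) (wordExp v) →
      AgreeMod (stdBasis P) P.prec (wordExp u) (wordProd P u) (stdBasis P (wordExp u))) :
    AgreeMod (stdBasis P) P.prec (wordExp v) (wordProd P v) (wordProd P w) := by
  induction h with
  | nil => exact AgreeMod.refl _ _
  | @cons a v w h hvw =>
    obtain ⟨c, hc, h1⟩ := hvw fun u hu => ih u <| by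
      rcases P.admissible.eq_or_prec_add (wordExp v) (Pi.single a 1) with h2 | h2
      · rw [wordExp_cons, ← h2]; exact hu
      · rw [wordExp_cons]; exact prec_trans P _ _ _ hu h2
    refine ⟨c, hc, ?_⟩
    rw [wordProd_cons, wordProd_cons, ← mul_smul_comm, ← mul_sub]
    refine map_mem_of_mem_lower (LinearMap.mulLeft k (P.x a)) h1 fun γ hγ => ?_
    have hlt : P.prec (wordExp (a :: stdWord γ)) (wordExp (a :: v)) := by
      rw [wordExp_cons, wordExp_cons, wordExp_stdWord, add_comm, add_comm _ (wordExp v)]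
      exact P.admissible.add_right _ _ _ hγ
    have := (ih (a :: stdWord γ) hlt).mem_lower_of_prec (prec_trans P) hlt
    rwa [wordProd_cons, wordProd_stdWord] at this
  | swap i j l =>
    obtain ⟨c, hc, h1⟩ := agreeMod_gen_mul_gen P i j
    refine ⟨c, hc, ?_⟩
    simp only [wordProd_cons]
    rw [← mul_assoc, ← mul_assoc, ← smul_mul_assoc, ← sub_mul]
    refine map_mem_of_mem_lower (LinearMap.mulRight k (wordProd P l)) h1 fun γ hγ => ?_
    have hlt : P.prec (wordExp (stdWord γ ++ l)) (wordExp (j :: i :: l)) := by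
      rw [wordExp_append, wordExp_stdWord, wordExp_cons, wordExp_cons, ← add_assoc,
        add_comm (Pi.single j 1)]
      exact P.admissible.add_right _ _ _ hγ
    have := (ih _ hlt).mem_lower_of_prec (prec_trans P) hlt
    rwa [wordProd_append, wordProd_stdWord] at this
  | @trans u v w huv hvw h1 h2 =>
    -- Permuted words share their exponent, so `ih` serves both halves.
    have he : wordExp u = wordExp v := funext fun i => huv.count_eq i
    refine (h1 ih).trans ?_
    rw [he] at ih ⊢
    exact h2 ih

/-- Every word in the generators is, up to a nonzero scalar and smaller terms, the standard
monomial with the same exponent. -/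
theorem agreeMod_wordProd (w : List (Fin n)) :
    AgreeMod (stdBasis P) P.prec (wordExp w) (wordProd P w) (stdBasis P (wordExp w)) := by
  induction h : wordExp w using P.admissible.wellFounded.induction generalizing w with
  | _ δ ih =>
    subst h
    -- Sort the letters of `w`; the error terms are covered by induction on the exponent.
    have := agreeMod_of_perm P (perm_stdWord w) fun u hu => ih _ hu u rfl
    rwa [wordProd_stdWord] at this

theorem agreeMod_stdMonomial_mul (α β : Fin n → ℕ) :
    AgreeMod (stdBasis P) P.prec (α + β) (stdMonomial P.x α * stdMonomial P.x β)
      (stdBasis P (α + β)) := by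
  have := agreeMod_wordProd P (stdWord α ++ stdWord β)
  rwa [wordExp_append, wordExp_stdWord, wordExp_stdWord, wordProd_append, wordProd_stdWord,
    wordProd_stdWord, stdBasis_apply P α, stdBasis_apply P β] at this

theorem isExp_stdMonomial_smul {ι : Type*} [Preorder ι] (γ : Fin n → ℕ) {f : ι → R}
    {e : (Fin n → ℕ) × ι} (h : IsExp (stdBasis P) P.prec f e) :
    IsExp (stdBasis P) P.prec
      ((stdMonomial P.x γ ⊗ₜ[k] MulOpposite.op 1 : Env k R) • f) (γ + e.1, e.2) := by
  have := isExp_map (b := stdBasis P) P.admissible.irrefl (prec_trans P)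
    (LinearMap.mulLeft k (stdMonomial P.x γ))
    (fun α => γ + α) (fun α => ?_) id Function.injective_id (fun i j hij => hij) (lt_irrefl e.2)
    (e₀ := e.1) h (fun α hα => ?_)
  · convert this using 1
    funext l
    rw [Pi.smul_apply, env_smul, mul_one]
    rfl
  · have := agreeMod_stdMonomial_mul P γ α
    rwa [← stdBasis_apply P α] at this
  · rw [add_comm γ, add_comm γ]
    exact P.admissible.add_right _ _ _ hα

theorem agreeMod_mulMap (e : (Fin n → ℕ) × (Fin n → ℕ)) :
    AgreeMod (stdBasis P) P.prec (e.1 + opTuple e.2) (mulMap k R (envBasis P e))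
      (stdBasis P (e.1 + opTuple e.2)) := by
  obtain ⟨α, β⟩ := e
  rw [envBasis_apply, mulMap_tmul]
  exact agreeMod_stdMonomial_mul P α (opTuple β)

theorem opTuple_opTuple (α : Fin n → ℕ) : opTuple (opTuple α) = α := by
  funext i; simp [opTuple]

theorem opTuple_zero : opTuple (0 : Fin n → ℕ) = 0 := rfl

theorem repr_one : (stdBasis P).repr 1 = Finsupp.single 0 1 := by
  rw [← stdMonomial_zero P.x, ← stdBasis_apply, Module.Basis.repr_self]

theorem envBasis_repr_tmul (u v : R) (α β : Fin n → ℕ) :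
    (envBasis P).repr (u ⊗ₜ[k] MulOpposite.op v) (α, β) =
      (stdBasis P).repr v (opTuple β) * (stdBasis P).repr u α := by
  rw [envBasis, Module.Basis.repr_reindex_apply]
  exact Module.Basis.tensorProduct_repr_tmul_apply _ _ _ _ _ _

end Monomials

/-! ### Syzygies of `H` and the intersection -/

section Lifts

variable {k R : Type*} [Field k] [Ring R] [Algebra k R] {s r : ℕ} {t : Fin r → ℕ}

/-- Seen as the action on 1, 𝔪 is visibly linear over the enveloping algebra, and the rows (I_s …
I_s) of `H` produce 𝔪^s(h'). -/
theorem smul_one_eq_mulMap (h : Env k R) : h • (1 : R) = mulMap k R h := by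
  induction h using TensorProduct.induction_on with
  | zero => exact (zero_smul (Env k R) (1 : R)).trans (map_zero _).symm
  | add a b ha hb => rw [add_smul, map_add, ha, hb]
  | tmul a b =>
    rw [← MulOpposite.op_unop b, env_smul, mulMap_tmul, mul_one]

theorem mulMapPi_smul {ι : Type*} (a : Env k R) (h : ι → Env k R) :
    mulMapPi (a • h) = a • mulMapPi h := by
  funext i
  simp only [mulMapPi, Pi.smul_apply, smul_eq_mul, ← smul_one_eq_mulMap, mul_smul]

variable (k R s t) in
/-- The map `(h', h'') ↦ 𝔪^s(h')`, as a map of bimodules. -/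
noncomputable def firstMul : (RowIdx s t → Env k R) →ₗ[Env k R] (Fin s → R) where
  toFun h := mulMapPi (firstPart h)
  map_add' a b := by funext i; simp [mulMapPi, firstPart]
  map_smul' a h := mulMapPi_smul a (firstPart h)

theorem mem_syz_matrixH (f : (i : Fin r) → Fin (t i) → (Fin s → R)) (h : RowIdx s t → Env k R) :
    h ∈ syz k (matrixH f) ↔
      ∀ i, mulMapPi (firstPart h) +
        ∑ j, h (toLex (Sum.inr (toLex ⟨i, j⟩))) • f i j = 0 := by
  have key : ∀ (i : Fin r) (l : Fin s),
      Fintype.linearCombination (Env k R) (fun a => matrixH f a) h (i, l) =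
        (mulMapPi (firstPart h) + ∑ j, h (toLex (Sum.inr (toLex ⟨i, j⟩))) • f i j) l := by
    intro i l
    rw [Fintype.linearCombination_apply, Finset.sum_apply,
      ← (toLex (α := Fin s ⊕ Σₗ i : Fin r, Fin (t i))).sum_comp, Fintype.sum_sum_type,
      ← (toLex (α := Σ i : Fin r, Fin (t i))).sum_comp, Fintype.sum_sigma, Pi.add_apply]
    congr 1
    · simp [matrixH, mulMapPi, firstPart, smul_one_eq_mulMap]
    · rw [Finset.sum_eq_single i]
      · simp [matrixH]
      · intro i' _ hi'
        simp [matrixH, hi']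
      · simp
  rw [syz, LinearMap.mem_ker, funext_iff, Prod.forall]
  refine forall_congr' fun i => ?_
  rw [funext_iff]
  exact forall_congr' fun l => by rw [← key]; rfl

variable {f : (i : Fin r) → Fin (t i) → (Fin s → R)}

theorem firstMul_mem_iInf {h : RowIdx s t → Env k R} (hh : h ∈ syz k (matrixH f)) :
    firstMul k R s t h ∈ ⨅ i, Submodule.span (Env k R) (Set.range (f i)) := by
  rw [Submodule.mem_iInf]
  intro i
  have := eq_neg_of_add_eq_zero_left ((mem_syz_matrixH f h).1 hh i)
  change mulMapPi (firstPart h) ∈ _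
  rw [this]
  exact neg_mem (Submodule.sum_mem _ fun j _ =>
    Submodule.smul_mem _ _ (Submodule.subset_span ⟨j, rfl⟩))

/-- Every lift h' extends to a syzygy, which leaves the choice between u ⊗ 1 and 1 ⊗ u free. -/
theorem exists_mem_syz {h' : Fin s → Env k R}
    (hh : mulMapPi h' ∈ ⨅ i, Submodule.span (Env k R) (Set.range (f i))) :
    ∃ h ∈ syz k (matrixH f), firstPart h = h' := by
  rw [Submodule.mem_iInf] at hh
  choose c hc using fun i => (Submodule.mem_span_range_iff_exists_fun _).1 (hh i)
  -- h'' consists of the negated coefficients of 𝔪^s(h') with respect to the generators of each Mᵢ.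
  refine ⟨fun a => Sum.elim h' (fun x => -c (ofLex x).1 (ofLex x).2) (ofLex a), ?_, rfl⟩
  rw [mem_syz_matrixH]
  intro i
  simp only [ofLex_toLex, Sum.elim_inr, neg_smul, Finset.sum_neg_distrib, hc i]
  exact add_neg_cancel _

theorem map_firstMul_syz :
    (syz k (matrixH f)).map (firstMul k R s t) =
      ⨅ i, Submodule.span (Env k R) (Set.range (f i)) := by
  refine le_antisymm (Submodule.map_le_iff_le_comap.2 fun h hh => firstMul_mem_iInf hh) ?_
  intro u hu
  have : mulMapPi (fun l => (u l ⊗ₜ[k] MulOpposite.op 1 : Env k R)) = u := by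
    funext l; rw [mulMapPi, mulMap_tmul, mul_one]
  obtain ⟨h, hh, h1⟩ := exists_mem_syz (this.symm ▸ hu)
  exact ⟨h, hh, (congrArg mulMapPi h1).trans this⟩

end Lifts

/-! ### Leading exponents over the enveloping algebra -/

section Env

variable {n : ℕ} {prec : (Fin n → ℕ) → (Fin n → ℕ) → Prop}

/-- For the orders considered on the enveloping algebra, one of the two embeddings of `ℕⁿ` into
`ℕ^{2n}` preserves the order, and exponents below its image have smaller total exponent. -/
theorem IsEnvOrder.left_or_right (h : IsAdmissible prec)
    {precE : (Fin n → ℕ) × (Fin n → ℕ) → (Fin n → ℕ) × (Fin n → ℕ) → Prop}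
    (hE : IsEnvOrder prec precE) :
    ((∀ γ α, prec γ α → precE (γ, 0) (α, 0)) ∧
      ∀ e α, precE e (α, 0) → prec (e.1 + opTuple e.2) α) ∨
    ((∀ γ α, prec γ α → precE (0, opTuple γ) (0, opTuple α)) ∧
      ∀ e β, precE e (0, β) → prec (e.1 + opTuple e.2) (opTuple β)) := by
  rcases hE with rfl | rfl | hE
  -- Among exponents of total α, (α, 0) is the least for `compUp`, as a tie would need a second
  -- block below 0. For `compDown` the least one has first block 0.
  · refine Or.inl ⟨fun γ α hγ => Or.inl (by simpa [opTuple_zero] using hγ), ?_⟩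
    rintro e α (h1 | h1)
    · simpa [opTuple_zero] using h1
    · exact absurd h1.2 (h.not_prec_zero _)
  · refine Or.inr ⟨fun γ α hγ => Or.inl (by simpa [opTuple_opTuple] using hγ), ?_⟩
    rintro e β (h1 | h1)
    · simpa using h1
    · exact absurd h1.2 (h.not_prec_zero _)
  · rcases hE.elim with h1 | h1
    · refine Or.inl ⟨fun γ α => (hE.restrict_left γ α).2, ?_⟩
      rintro ⟨a, b⟩ α hab
      by_cases hb : b = 0
      · subst hb
        simpa [opTuple_zero] using (hE.restrict_left a α).1 hab
      -- By elimination, only exponents (γ, 0) lie below (α, 0).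
      · exact absurd (hE.admissible.trans hab (h1 a b α hb)) (hE.admissible.irrefl _)
    · refine Or.inr ⟨fun γ α hγ => (hE.restrict_right _ _).2
        (by simpa [opTuple_opTuple] using hγ), ?_⟩
      rintro ⟨a, b⟩ β hab
      by_cases ha : a = 0
      · subst ha
        simpa using (hE.restrict_right b β).1 hab
      · exact absurd (hE.admissible.trans hab (h1 a b β ha)) (hE.admissible.irrefl _)

variable {k R : Type*} [Field k] [Ring R] [Algebra k R] (P : PBWAlgebra k R n) {s r : ℕ}
  {t : Fin r → ℕ}
  {precE : (Fin n → ℕ) × (Fin n → ℕ) → (Fin n → ℕ) × (Fin n → ℕ) → Prop}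

/-- If the nonzero exponents of `h'` are the images under `ν` of those of `u`, and `ν` preserves
the order, then the leading exponent of `(h', h'')` comes from that of `u`. -/
theorem isExp_of_firstPart {h : RowIdx s t → Env k R} {u : Fin s → R}
    {a : (Fin n → ℕ) × Fin s} (hu : IsExp (stdBasis P) P.prec u a)
    (ν : (Fin n → ℕ) → (Fin n → ℕ) × (Fin n → ℕ))
    (hν : ∀ γ α, P.prec γ α → precE (ν γ) (ν α))
    (h1 : (envBasis P).repr (firstPart h a.2) (ν a.1) ≠ 0)
    (h2 : ∀ l e, (envBasis P).repr (firstPart h l) e ≠ 0 →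
      ∃ γ, e = ν γ ∧ (stdBasis P).repr (u l) γ ≠ 0) :
    IsExp (envBasis P) precE h (ν a.1, toLex (Sum.inl a.2)) := by
  refine ⟨h1, ?_⟩
  rintro ⟨e, x⟩ he
  induction x using Lex.rec with | _ x
  rcases x with l | x
  · obtain ⟨γ, rfl, hγ⟩ := h2 l e he
    rcases hu.2 (γ, l) hγ with h3 | h3 | h3
    · left; rw [← h3]
    · exact Or.inr (Or.inl (Sum.Lex.inl_lt_inl_iff.2 h3))
    · refine Or.inr (Or.inr ⟨?_, hν _ _ h3.2⟩)
      exact congrArg (fun l => toLex (Sum.inl l)) h3.1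
  -- Positions of h'' come after those of h', so POT makes them irrelevant whatever h'' is.
  · exact Or.inr (Or.inl (Sum.Lex.inl_lt_inr _ _))

/-- `hd` excludes cancellation of the leading term under 𝔪. It fails for general `e`, but holds when
the block of `e` selected by `IsEnvOrder.left_or_right` is zero. -/
theorem isExp_firstMul {g : RowIdx s t → Env k R} {e : (Fin n → ℕ) × (Fin n → ℕ)} {i : Fin s}
    (hg : IsExp (envBasis P) precE g (e, toLex (Sum.inl i)))
    (hd : ∀ e', precE e' e → P.prec (e'.1 + opTuple e'.2) (e.1 + opTuple e.2)) :
    IsExp (stdBasis P) P.prec (mulMapPi (firstPart g)) (e.1 + opTuple e.2, i) := by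
  have hu : Function.Injective (fun l : Fin s => (toLex (Sum.inl l) : RowIdx s t)) :=
    fun _ _ h => Sum.inl_injective (toLex.injective h)
  exact isExp_map (b := stdBasis P) (b' := envBasis P) P.admissible.irrefl (prec_trans P)
    (mulMap k R) (fun e => e.1 + opTuple e.2) (agreeMod_mulMap P) _ hu
    (fun _ _ h => Sum.Lex.inl_lt_inl_iff.1 h) (g := g) (e₀ := e) (i := i) (lt_irrefl i) hg hd

theorem IsExp.ne_zero {E ι : Type*} [LT ι] {b : Module.Basis E k R} {prec : E → E → Prop}
    {f : ι → R} {a : E × ι} (h : IsExp b prec f a) : f ≠ 0 := by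
  rintro rfl
  exact h.1 (by simp)

/-- The leading exponents of the intersection are multiples of those of the `𝔪^s(g')`. -/
theorem expSet_iInf_subset (hE : IsEnvOrder P.prec precE)
    {f : (i : Fin r) → Fin (t i) → (Fin s → R)} {G : Set (RowIdx s t → Env k R)}
    (hG : IsLeftGrobnerBasis (envBasis P) precE (syz k (matrixH f)) G)
    {u : Fin s → R} (hu : u ∈ ⨅ i, Submodule.span (Env k R) (Set.range (f i)))
    {a : (Fin n → ℕ) × Fin s} (ha : IsExp (stdBasis P) P.prec u a) :
    a ∈ expCone (stdBasis P) P.prec ((fun g => mulMapPi (firstPart g)) '' G \ {0}) := by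
  rcases hE.left_or_right P.admissible with ⟨h1, h2⟩ | ⟨h1, h2⟩
  · have hlift : mulMapPi (fun l => (u l ⊗ₜ[k] MulOpposite.op 1 : Env k R)) = u := by
      funext l; rw [mulMapPi, mulMap_tmul, mul_one]
    obtain ⟨h, hh, hfp⟩ := exists_mem_syz (hlift.symm ▸ hu)
    have hexp : IsExp (envBasis P) precE h ((a.1, 0), toLex (Sum.inl a.2)) := by
      refine isExp_of_firstPart P ha (fun γ => (γ, 0)) h1 ?_ ?_
      · rw [hfp, envBasis_repr_tmul, repr_one, opTuple_zero, Finsupp.single_eq_same, one_mul]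
        exact ha.1
      · rintro l ⟨γ, δ⟩ he
        rw [hfp, envBasis_repr_tmul, repr_one, Finsupp.single_apply] at he
        have hδ : 0 = opTuple δ := by
          by_contra hne
          simp [hne] at he
        have hδ' : δ = 0 := by rw [← opTuple_opTuple δ, ← hδ, opTuple_zero]
        exact ⟨γ, by rw [hδ'], right_ne_zero_of_mul he⟩
    obtain ⟨g, hg, ⟨⟨α, β⟩, i⟩, hge, ⟨γ, δ⟩, hγ⟩ :=
      hG.2.2.subset ⟨h, hh, hexp⟩
    simp only [Prod.mk_add_mk, Prod.mk.injEq] at hγ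
    obtain ⟨⟨h3, h4⟩, rfl⟩ := hγ
    -- A divisor of an exponent with zero second block has zero second block.
    obtain rfl : β = 0 := (add_eq_zero.1 h4.symm).2
    have hexp' := isExp_firstMul P hge fun e' he' => by
      simpa [opTuple_zero] using h2 _ _ he'
    rw [opTuple_zero, add_zero] at hexp'
    exact ⟨_, ⟨⟨g, hg, rfl⟩, hexp'.ne_zero⟩, _, hexp', γ, Prod.ext h3 rfl⟩
  · have hlift : mulMapPi (fun l => (1 ⊗ₜ[k] MulOpposite.op (u l) : Env k R)) = u := by
      funext l; rw [mulMapPi, mulMap_tmul, one_mul]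
    obtain ⟨h, hh, hfp⟩ := exists_mem_syz (hlift.symm ▸ hu)
    have hexp : IsExp (envBasis P) precE h ((0, opTuple a.1), toLex (Sum.inl a.2)) := by
      refine isExp_of_firstPart P ha (fun γ => (0, opTuple γ)) h1 ?_ ?_
      · rw [hfp, envBasis_repr_tmul, repr_one, opTuple_opTuple, Finsupp.single_eq_same, mul_one]
        exact ha.1
      · rintro l ⟨γ, δ⟩ he
        rw [hfp, envBasis_repr_tmul, repr_one, Finsupp.single_apply] at he
        have hγ : 0 = γ := by
          by_contra hne
          simp [hne] at he
        exact ⟨opTuple δ, by rw [opTuple_opTuple, hγ], left_ne_zero_of_mul he⟩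
    obtain ⟨g, hg, ⟨⟨α, β⟩, i⟩, hge, ⟨γ, δ⟩, hγ⟩ :=
      hG.2.2.subset ⟨h, hh, hexp⟩
    simp only [Prod.mk_add_mk, Prod.mk.injEq] at hγ
    obtain ⟨⟨h3, h4⟩, rfl⟩ := hγ
    obtain rfl : α = 0 := (add_eq_zero.1 h3.symm).2
    have hexp' := isExp_firstMul P hge fun e' he' => by
      simpa using h2 _ _ he'
    rw [zero_add] at hexp'
    -- Reversing a.1^op = δ + β gives the cofactor δ^op.
    refine ⟨_, ⟨⟨g, hg, rfl⟩, hexp'.ne_zero⟩, _, hexp', opTuple δ, Prod.ext ?_ rfl⟩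
    rw [← opTuple_opTuple a.1, h4]
    rfl

/-- Multiplying on the left by x^γ, the action of x^γ ⊗ 1, shifts leading exponents by γ. -/
theorem expCone_subset_expSet {ι : Type*} [Preorder ι] (N : Submodule (Env k R) (ι → R))
    {G : Set (ι → R)} (hG : G ⊆ N) :
    expCone (stdBasis P) P.prec G ⊆ expSet (stdBasis P) P.prec (N : Set (ι → R)) := by
  rintro _ ⟨g, hg, e, he, γ, rfl⟩
  exact ⟨_, N.smul_mem _ (hG hg), isExp_stdMonomial_smul P γ he⟩

end Env

end PBW

/-! ### Generators and Gröbner basis of the intersection -/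

theorem mainTheorem5 {k R : Type*} [Field k] [Ring R] [Algebra k R] {n : ℕ}
    (P : PBWAlgebra k R n) {s r : ℕ} (t : Fin r → ℕ)
    (f : (i : Fin r) → Fin (t i) → (Fin s → R))
    (M : Fin r → Submodule (PBW.Env k R) (Fin s → R))
    (hM : ∀ i, M i = Submodule.span (PBW.Env k R) (Set.range (f i)))
    {T : ℕ} (g : Fin T → (PBW.RowIdx s t → PBW.Env k R))
    (hg : PBW.syz k (PBW.matrixH f) = Submodule.span (PBW.Env k R) (Set.range g)) :
    Submodule.span (PBW.Env k R)
        (Set.range fun j => PBW.mulMapPi (PBW.firstPart (g j))) = (⨅ i, M i) ∧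
    ∀ precE : (Fin n → ℕ) × (Fin n → ℕ) → (Fin n → ℕ) × (Fin n → ℕ) → Prop,
      PBW.IsEnvOrder P.prec precE →
      PBW.IsLeftGrobnerBasis (PBW.envBasis P) precE (PBW.syz k (PBW.matrixH f)) (Set.range g) →
      PBW.IsTwoSidedGrobnerBasis P (⨅ i, M i)
        ((Set.range fun j => PBW.mulMapPi (PBW.firstPart (g j))) \ {0}) := by
  obtain rfl : M = fun i => Submodule.span (PBW.Env k R) (Set.range (f i)) := funext hM
  have hspan : Submodule.span (PBW.Env k R)
      (Set.range fun j => PBW.mulMapPi (PBW.firstPart (g j))) =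
        ⨅ i, Submodule.span (PBW.Env k R) (Set.range (f i)) := by
    rw [← PBW.map_firstMul_syz, hg, Submodule.map_span, ← Set.range_comp]
    rfl
  refine ⟨hspan, fun precE hE hG => ⟨(Set.finite_range _).sdiff, ?_, ?_, ?_⟩⟩
  · rw [← hspan]
    exact Set.sdiff_subset_sdiff_left Submodule.subset_span
  · rw [Submodule.span_sdiff_singleton_zero, hspan]
  · refine Set.Subset.antisymm ?_ (PBW.expCone_subset_expSet P _ ?_)
    · rintro a ⟨u, hu, ha⟩
      have := PBW.expSet_iInf_subset P hE hG hu ha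
      rwa [← Set.range_comp] at this
    · rw [← hspan]
      exact Set.sdiff_subset.trans Submodule.subset_span
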